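/- Let $c,e,m$ be integers with $m>1$ and $e\neq 0$, and let $d$ be a positive rational such that $dm^2$ and $dcm/e$ are positive integers. Put \[ a=\frac{e-\sqrt{e^2+4e/c}}{2},\qquad b=\frac{e+\sqrt{e^2+4e/c}}{2}, \] and write $(z;q)_n=\prod_{k=0}^{n-1}(1-zq^k)$ (so $(z;q)_0=1$). Here $[0;\overline{f_1(n),\dots,f_k(n)}]_{n=1}^{\infty}$ denotes the infinite continued fraction $[0;f_1(1),\dots,f_k(1),f_1(2),\dots,f_k(2),\dots]$. (i) Suppose that $dcm/e-c-2>0$ and $dm^2+e-2>0$. Then \[ \left[0;\overline{1,\tfrac{dc}{e}m^{2n-1}-c-2,1,dm^{2n}+e-2}\,\right]_{n=1}^{\infty} =1+\frac{e/c}{-md+a}\cdot \frac{\displaystyle\sum_{n=0}^{\infty}\frac{(b/d)^n(-m)^{-n(n+3)/2}}{(-1/m;-1/m)_n\,(-a/(dm^2);-1/m)_n}} {\displaystyle\sum_{n=0}^{\infty}\frac{(b/d)^n(-m)^{-n(n+1)/2}}{(-1/m;-1/m)_n\,(a/(dm);-1/m)_n}}. \] (ii) Suppose that $dcm/e+c-1>0$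 and $dm^2-e-2>0$. Then \[ \left[0;\tfrac{dc}{e}m+c-1,\overline{1,dm^{2n}-e-2,1,\tfrac{dc}{e}m^{2n+1}+c-2}\,\right]_{n=1}^{\infty} =\frac{e/c}{md+a}\cdot \frac{\displaystyle\sum_{n=0}^{\infty}\frac{(-b/d)^n(-m)^{-n(n+3)/2}}{(-1/m;-1/m)_n\,(a/(dm^2);-1/m)_n}} {\displaystyle\sum_{n=0}^{\infty}\frac{(-b/d)^n(-m)^{-n(n+1)/2}}{(-1/m;-1/m)_n\,(-a/(dm);-1/m)_n}}. \] In both cases all partial quotients after the initial $0$ are positive integers, the continued fraction and the series converge, and no denominator on the right-hand side vanishes. -/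

import Mathlib

open Filter Topology

namespace Tasoev

noncomputable section

/-- The `q`-product `(z; q)_n = ∏_{k < n} (1 - z q^k)`. -/
def qProd (z q : ℝ) (n : ℕ) : ℝ :=
  ∏ k ∈ Finset.range n, (1 - z * q ^ k)

/-- The `n`-th term
`β^n M^{-n(n+r)/2} / ((1/M; 1/M)_n (α; 1/M)_n)`
of the series used below (only with `r = 1` and `r = 3`, where `n(n+r)/2` is an integer). -/
def qTerm (β M α : ℝ) (r n : ℕ) : ℝ :=
  β ^ n * M ^ (-((n * (n + r) / 2 : ℕ) : ℤ)) / (qProd (1 / M) (1 / M) n * qProd α (1 / M) n)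

/-- The sum over `n ≥ 0` of the terms `qTerm β M α r n`. -/
def qSeries (β M α : ℝ) (r : ℕ) : ℝ :=
  ∑' n : ℕ, qTerm β M α r n

/-- The series is meaningful: no term has a vanishing denominator, and it converges. -/
def QSeriesDefined (β M α : ℝ) (r : ℕ) : Prop :=
  (∀ n : ℕ, qProd (1 / M) (1 / M) n ≠ 0 ∧ qProd α (1 / M) n ≠ 0) ∧
    Summable (fun n : ℕ => qTerm β M α r n)

/-- The infinite continued fraction `[0; b 0, b 1, b 2, …]` (all partial numerators are `1`). -/
def zeroCF (b : ℕ → ℝ) : GenContFract ℝ where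
  h := 0
  s := Stream'.Seq.ofStream (fun k : ℕ => (⟨1, b k⟩ : GenContFract.Pair ℝ))

/-- `[0; b 0, b 1, b 2, …]` is a regular continued fraction (its partial quotients after the
initial `0` are positive integers), it converges, and its value is `v`. -/
def IsRegularCFOf (b : ℕ → ℝ) (v : ℝ) : Prop :=
  (∀ k : ℕ, ∃ N : ℕ, 0 < N ∧ b k = (N : ℝ)) ∧
    Tendsto (fun k : ℕ => (zeroCF b).convs k) atTop (𝓝 v)

/-- The sequence `f₀(1), f₁(1), f₂(1), f₃(1), f₀(2), f₁(2), f₂(2), f₃(2), f₀(3), …`. -/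
def interlace4 (f : Fin 4 → ℕ → ℝ) (k : ℕ) : ℝ :=
  f ⟨k % 4, Nat.mod_lt k (by norm_num)⟩ (k / 4 + 1)

/-- The sequence `1, (dc/e) m^{2n-1} - c - 2, 1, d m^{2n} + e - 2`, with `n = 1, 2, 3, …`. -/
def quotientsOne (c e m d : ℝ) : ℕ → ℝ :=
  interlace4 ![fun _ => 1, fun n => d * c / e * m ^ (2 * n - 1) - c - 2,
    fun _ => 1, fun n => d * m ^ (2 * n) + e - 2]

/-- The sequence that starts with `(dc/e) m + c - 1` and continues with
`1, d m^{2n} - e - 2, 1, (dc/e) m^{2n+1} + c - 2`, with `n = 1, 2, 3, …`. -/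
def quotientsTwo (c e m d : ℝ) : ℕ → ℝ
  | 0 => d * c / e * m + c - 1
  | k + 1 => interlace4 ![fun _ => 1, fun n => d * m ^ (2 * n) - e - 2,
      fun _ => 1, fun n => d * c / e * m ^ (2 * n + 1) + c - 2] k

end

end Tasoev

namespace Tasoev

/-! Put q = -1/m and s = e/c, so that a and b are the roots of X² - eX - s. The sums F(t) =
`hyperSum a b q t` satisfy a three-term recurrence in F(t), F(tq), F(tq²) (`hyperSum_contiguous`).
Along t_i = q^(i+1)/(σd), with σ = 1 for (i) and σ = -1 for (ii), suitably normalized ratios w_i of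
F(t_(i+1)) to F(t_i) satisfy w_i = 1/(C_i - w_(i+1)), where C_i is the integer `negCoeff`. Thus w_0,
essentially the quotient of the two series in the theorem, is formally a continued fraction with
minus signs.

The identity 1 - 1/(C - w) = 1/(1 + 1/(C - 2 + (1 - w))) turns it into the regular fraction with
quotients 1, C_i - 2 (`tails_of_negative`). In (i) its value is 1 - w_0; in (ii) w_0 = 1/((C_0 - 1)
+ (1 - w_1)), so only the tail from w_1 is converted.

What remains is 0 < w_i < 1. This holds for large i because F(t_i) → 1 and w_i → 0, and it descends
to every i through the recurrence, since C_i ≥ 2 (`exists_negative_tails`). The same descent gives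
F(t_i) > 0, hence the nonvanishing denominator. Tails in (0, 1) make the fraction the floor
expansion of its value, so convergence is automatic (`isRegularCFOf_of_tails`). -/

/-! ### The q-products and the contiguous relation. -/

lemma qProd_zero (z q : ℝ) : qProd z q 0 = 1 := by simp [qProd]

lemma qProd_succ (z q : ℝ) (n : ℕ) : qProd z q (n + 1) = qProd z q n * (1 - z * q ^ n) := by
  simp [qProd, Finset.prod_range_succ]

lemma qProd_succ_left (z q : ℝ) (n : ℕ) :
    qProd z q (n + 1) = (1 - z) * qProd (z * q) q n := by
  simp only [qProd, Finset.prod_range_succ', pow_zero, mul_one]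
  rw [mul_comm]
  congr 1
  refine Finset.prod_congr rfl fun k _ => ?_
  ring

lemma qProd_ne_zero {z q : ℝ} (h : ∀ k : ℕ, 1 - z * q ^ k ≠ 0) (n : ℕ) : qProd z q n ≠ 0 :=
  Finset.prod_ne_zero_iff.2 fun k _ => h k

/-- The `n`-th term of the basic hypergeometric series
`∑ (b t)^n q^{n(n-1)/2} / ((q; q)_n (-a t; q)_n)`. -/
noncomputable def hyperTerm (a b q t : ℝ) (n : ℕ) : ℝ :=
  (b * t) ^ n * q ^ n.choose 2 / (qProd q q n * qProd (-(a * t)) q n)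

/-- The sum of the terms `hyperTerm a b q t n`. -/
noncomputable def hyperSum (a b q t : ℝ) : ℝ := ∑' n, hyperTerm a b q t n

lemma hyperTerm_zero (a b q t : ℝ) : hyperTerm a b q t 0 = 1 := by
  simp [hyperTerm, qProd_zero]

/-- The recurrence for the sums holds term by term once the series multiplied by `b * t` and the
last one are shifted by one index. After all products are reduced to `qProd q q n` and `qProd (-(a *
(t * q))) q n`, it is a rational identity. -/
lemma hyperTerm_contiguous {a b q t : ℝ} (hq : ∀ n : ℕ, 1 - q * q ^ n ≠ 0)
    (ht : ∀ n : ℕ, 1 - -(a * t) * q ^ n ≠ 0) (n : ℕ) :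
    (1 + a * t) * hyperTerm a b q t (n + 1) =
      (1 + a * t) * hyperTerm a b q (t * q) (n + 1) + b * t * hyperTerm a b q (t * q) n -
        a * b * t ^ 2 * q / (1 + a * t * q) * hyperTerm a b q (t * q * q) n := by
  have hP := qProd_ne_zero hq n
  have hx0 : 1 + a * t ≠ 0 := by simpa using ht 0
  have hx1 : 1 + a * t * q ≠ 0 := by simpa using ht 1
  have hxn : 1 + a * t * q * q ^ n ≠ 0 := by
    have := ht (n + 1)
    rw [pow_succ] at this
    convert this using 1
    ring
  have hqn := hq n
  have hQ : qProd (-(a * (t * q))) q n ≠ 0 := by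
    refine qProd_ne_zero (fun k => ?_) n
    have := ht (k + 1)
    rw [pow_succ] at this
    convert this using 1
    ring
  have hR : qProd (-(a * (t * q * q))) q n =
      qProd (-(a * (t * q))) q n * (1 + a * t * q * q ^ n) / (1 + a * t * q) := by
    have h1 := qProd_succ (-(a * (t * q))) q n
    rw [qProd_succ_left] at h1
    rw [eq_div_iff hx1]
    have h2 : -(a * (t * q)) * q = -(a * (t * q * q)) := by ring
    rw [h2] at h1
    linear_combination h1
  have hL : qProd (-(a * t)) q (n + 1) = (1 + a * t) * qProd (-(a * (t * q))) q n := by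
    rw [qProd_succ_left]
    have h2 : -(a * t) * q = -(a * (t * q)) := by ring
    rw [h2]
    ring
  have hS : qProd (-(a * (t * q))) q (n + 1) =
      qProd (-(a * (t * q))) q n * (1 + a * t * q * q ^ n) := by
    rw [qProd_succ]
    ring
  have hch : (n + 1).choose 2 = n.choose 2 + n := by
    rw [Nat.choose_succ_succ' n 1, Nat.choose_one_right, add_comm]
  unfold hyperTerm
  rw [hR, hL, hS, qProd_succ q q n, hch]
  generalize qProd (-(a * (t * q))) q n = Q at *
  generalize qProd q q n = P at *
  simp only [mul_pow, pow_add, pow_one]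
  generalize q ^ n.choose 2 = c
  generalize q ^ n = z at *
  rw [mul_comm q z] at hqn ⊢
  rw [mul_right_comm] at hxn
  field_simp
  ring

lemma hyperSum_contiguous {a b q t : ℝ} (hq : ∀ n : ℕ, 1 - q * q ^ n ≠ 0)
    (ht : ∀ n : ℕ, 1 - -(a * t) * q ^ n ≠ 0) (h0 : Summable (hyperTerm a b q t))
    (h1 : Summable (hyperTerm a b q (t * q))) (h2 : Summable (hyperTerm a b q (t * q * q))) :
    (1 + a * t) * hyperSum a b q t = (1 + (a + b) * t) * hyperSum a b q (t * q) -
      a * b * t ^ 2 * q / (1 + a * t * q) * hyperSum a b q (t * q * q) := by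
  have e0 := h0.tsum_eq_zero_add
  have e1 := h1.tsum_eq_zero_add
  rw [hyperTerm_zero] at e0 e1
  have h1' := (summable_nat_add_iff 1).2 h1
  have key : (1 + a * t) * ∑' n, hyperTerm a b q t (n + 1) =
      (1 + a * t) * ∑' n, hyperTerm a b q (t * q) (n + 1) +
        b * t * ∑' n, hyperTerm a b q (t * q) n -
        a * b * t ^ 2 * q / (1 + a * t * q) * ∑' n, hyperTerm a b q (t * q * q) n := by
    rw [← tsum_mul_left, ← tsum_mul_left, ← tsum_mul_left, ← tsum_mul_left,
      ← (h1'.mul_left _).tsum_add (h1.mul_left _),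
      ← ((h1'.mul_left _).add (h1.mul_left _)).tsum_sub (h2.mul_left _)]
    exact tsum_congr fun n => hyperTerm_contiguous hq ht n
  unfold hyperSum
  linear_combination (1 + a * t) * e0 - (1 + a * t) * e1 + key

/-! ### Convergence of the series and its limit as t → 0. -/

lemma hyperTerm_succ (a b q t : ℝ) (n : ℕ) :
    hyperTerm a b q t (n + 1) =
      hyperTerm a b q t n * (b * t * q ^ n / ((1 - q * q ^ n) * (1 - -(a * t) * q ^ n))) := by
  have hch : (n + 1).choose 2 = n.choose 2 + n := by
    rw [Nat.choose_succ_succ' n 1, Nat.choose_one_right, add_comm]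
  rw [hyperTerm, hyperTerm, qProd_succ, qProd_succ, hch, div_mul_div_comm]
  congr 1 <;> ring

lemma summable_hyperTerm {a b q t : ℝ} (hq1 : |q| < 1) (hq0 : q ≠ 0) (hb : b * t ≠ 0)
    (hq : ∀ n : ℕ, 1 - q * q ^ n ≠ 0) (ht : ∀ n : ℕ, 1 - -(a * t) * q ^ n ≠ 0) :
    Summable (hyperTerm a b q t) := by
  have hne : ∀ n, hyperTerm a b q t n ≠ 0 := fun n =>
    div_ne_zero (mul_ne_zero (pow_ne_zero _ hb) (pow_ne_zero _ hq0))
      (mul_ne_zero (qProd_ne_zero hq n) (qProd_ne_zero ht n))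
  refine summable_of_ratio_test_tendsto_lt_one (l := 0) zero_lt_one
    (Eventually.of_forall hne) ?_
  have hp : Tendsto (fun n : ℕ => q ^ n) atTop (𝓝 0) :=
    tendsto_pow_atTop_nhds_zero_of_abs_lt_one hq1
  have h : Tendsto (fun n : ℕ => b * t * q ^ n / ((1 - q * q ^ n) * (1 - -(a * t) * q ^ n)))
      atTop (𝓝 (b * t * 0 / ((1 - q * 0) * (1 - -(a * t) * 0)))) :=
    (hp.const_mul _).div (((hp.const_mul _).const_sub 1).mul ((hp.const_mul _).const_sub 1))
      (by simp)
  have h' := h.norm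
  simp only [mul_zero, zero_div, norm_zero] at h'
  refine h'.congr fun n => ?_
  rw [hyperTerm_succ, norm_mul, mul_div_cancel_left₀ _ (norm_ne_zero_iff.2 (hne n))]

/-- Both factors in the denominator of the term ratio are at least 1/2 in absolute value, whence the
4. This gives the geometric majorant for dominated convergence. -/
lemma abs_hyperTerm_le {a b q t : ℝ} (hq : |q| ≤ 1 / 2) (hat : |a * t| ≤ 1 / 2) (n : ℕ) :
    |hyperTerm a b q t n| ≤ (4 * |b * t|) ^ n := by
  induction n with
  | zero => simp [hyperTerm_zero]
  | succ n ih =>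
    have hqn : |q ^ n| ≤ 1 := by
      rw [abs_pow]
      exact pow_le_one₀ (abs_nonneg _) (by linarith)
    have half : ∀ y : ℝ, |y| ≤ 1 / 2 → 1 / 2 ≤ |1 - y * q ^ n| := fun y hy => by
      have h1 : |y * q ^ n| ≤ 1 / 2 := by
        rw [abs_mul]
        calc |y| * |q ^ n| ≤ |y| * 1 := by gcongr
          _ ≤ 1 / 2 := by linarith
      have := abs_le.1 h1
      exact le_trans (by linarith) (le_abs_self _)
    have h1 := half q hq
    have h2 := half (-(a * t)) (by rwa [abs_neg])
    have h3 : 1 / 4 ≤ |1 - q * q ^ n| * |1 - -(a * t) * q ^ n| := by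
      calc (1 / 4 : ℝ) = 1 / 2 * (1 / 2) := by norm_num
        _ ≤ _ := by gcongr
    rw [hyperTerm_succ, abs_mul, pow_succ, abs_div, abs_mul, abs_mul (1 - q * q ^ n)]
    refine mul_le_mul ih ?_ (by positivity) (by positivity)
    rw [div_le_iff₀ (by linarith)]
    have hb := abs_nonneg (b * t)
    nlinarith [mul_le_mul_of_nonneg_left h3 hb, mul_le_mul_of_nonneg_left hqn hb]

lemma tendsto_hyperSum {a b q : ℝ} (hq : |q| ≤ 1 / 2) {t : ℕ → ℝ}
    (ht : Tendsto t atTop (𝓝 0)) :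
    Tendsto (fun i => hyperSum a b q (t i)) atTop (𝓝 1) := by
  have hat : Tendsto (fun i => |a * t i|) atTop (𝓝 0) := by
    simpa using (ht.const_mul a).abs
  have hbt : Tendsto (fun i => 4 * |b * t i|) atTop (𝓝 0) := by
    simpa using (ht.const_mul b).abs.const_mul 4
  have ea : ∀ᶠ i in atTop, |a * t i| ≤ 1 / 2 := hat.eventually_le_const (by norm_num)
  have eb : ∀ᶠ i in atTop, 4 * |b * t i| ≤ 1 / 2 := hbt.eventually_le_const (by norm_num)
  have lim : Tendsto (fun i => ∑' n, hyperTerm a b q (t i) n) atTop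
      (𝓝 (∑' n : ℕ, if n = 0 then (1 : ℝ) else 0)) := by
    refine tendsto_tsum_of_dominated_convergence (bound := fun n => (1 / 2 : ℝ) ^ n)
      (summable_geometric_of_lt_one (by norm_num) (by norm_num)) (fun n => ?_) ?_
    · rcases Nat.eq_zero_or_pos n with rfl | hn
      · simp [hyperTerm_zero]
      · rw [if_neg hn.ne']
        have h0 : Tendsto (fun i => (4 * |b * t i|) ^ n) atTop (𝓝 0) := by
          simpa [hn.ne'] using hbt.pow n
        refine squeeze_zero_norm' ?_ h0
        filter_upwards [ea] with i hi
        exact abs_hyperTerm_le hq hi n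
    · filter_upwards [ea, eb] with i hi hi' n
      exact (abs_hyperTerm_le hq hi n).trans (pow_le_pow_left₀ (by positivity) hi' n)
  simpa [hyperSum] using lim

/-! ### From tails to regular continued fractions. -/

/-- If `x k = 1 / (b k + x (k + 1))` with positive integers `b k` and `x k ∈ (0, 1)`, then
`[0; b 0, b 1, …]` is a regular continued fraction of value `x 0`. -/
lemma isRegularCFOf_of_tails {b x : ℕ → ℝ} (hb : ∀ k, ∃ N : ℕ, 0 < N ∧ b k = (N : ℝ))
    (h0 : ∀ k, 0 < x k) (h1 : ∀ k, x k < 1) (hx : ∀ k, x k * (b k + x (k + 1)) = 1) :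
    IsRegularCFOf b (x 0) := by
  refine ⟨hb, ?_⟩
  have hfr : ∀ k, Int.fract (x k) = x k := fun k =>
    Int.fract_eq_self.2 ⟨(h0 k).le, h1 k⟩
  have hinv : ∀ k, (x k)⁻¹ = b k + x (k + 1) := fun k =>
    inv_eq_of_mul_eq_one_right (hx k)
  have hfr' : ∀ k, Int.fract ((x k)⁻¹) = x (k + 1) := fun k => by
    obtain ⟨N, -, hN⟩ := hb k
    rw [hinv, hN, Int.fract_natCast_add, hfr]
  have hfl : ∀ k, ((⌊(x k)⁻¹⌋ : ℤ) : ℝ) = b k := fun k => by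
    have := Int.floor_add_fract ((x k)⁻¹)
    rw [hfr'] at this
    linarith [hinv k]
  -- Only the fractional part of y matters, which lets the induction pass from y to the inverse of
  -- its fractional part, whose own fractional part is the next tail.
  have hs : ∀ n k (y : ℝ), Int.fract y = x k →
      (GenContFract.of y).s.get? n = some ⟨1, b (k + n)⟩ := by
    intro n
    induction n with
    | zero =>
      intro k y hy
      have := GenContFract.of_s_head (v := y) (by rw [hy]; exact (h0 k).ne')
      rw [hy, hfl] at this
      exact this
    | succ n ih =>
      intro k y hy
      rw [GenContFract.of_s_succ, hy, ih (k + 1) _ (hfr' k), Nat.add_right_comm, Nat.add_assoc]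
  have heq : GenContFract.of (x 0) = zeroCF b := by
    refine GenContFract.ext ?_ ?_
    · rw [GenContFract.of_h_eq_floor, Int.floor_eq_zero_iff.2 ⟨(h0 0).le, h1 0⟩]
      simp [zeroCF]
    · refine Stream'.Seq.ext fun n => ?_
      rw [hs n 0 _ (hfr 0), zero_add]
      rfl
  rw [← heq]
  exact GenContFract.of_convergence (x 0)

lemma tails_of_negative {C w : ℕ → ℝ} (hC : ∀ i, 3 ≤ C i) (hw0 : ∀ i, 0 < w i)
    (hw1 : ∀ i, w i < 1) (hw : ∀ i, w i * (C i - w (i + 1)) = 1) (k : ℕ) :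
    let x : ℕ → ℝ := fun k => if k % 2 = 0 then 1 - w (k / 2) else w (k / 2) / (1 - w (k / 2))
    0 < x k ∧ x k < 1 ∧
      x k * ((if k % 2 = 0 then 1 else C (k / 2) - 2) + x (k + 1)) = 1 := by
  intro x
  have p0 := hw0 (k / 2)
  have p1 := hw1 (k / 2)
  have p2 := hw0 (k / 2 + 1)
  have p3 := hw1 (k / 2 + 1)
  have pr := hw (k / 2)
  have pC := hC (k / 2)
  have hne : 1 - w (k / 2) ≠ 0 := by linarith
  rcases Nat.mod_two_eq_zero_or_one k with hk | hk
  · have hk' : (k + 1) % 2 = 1 := by omega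
    have hd : (k + 1) / 2 = k / 2 := by omega
    simp only [x, hk, hk', hd, if_true, one_ne_zero, if_false]
    refine ⟨by linarith, by linarith, ?_⟩
    field_simp
    ring
  · have hk' : (k + 1) % 2 = 0 := by omega
    have hd : (k + 1) / 2 = k / 2 + 1 := by omega
    simp only [x, hk, hk', hd, if_true, one_ne_zero, if_false]
    refine ⟨div_pos p0 (by linarith), ?_, ?_⟩
    · rw [div_lt_one (by linarith)]
      nlinarith
    · rw [div_mul_eq_mul_div, div_eq_one_iff_eq hne]
      linear_combination pr

/-! ### Solving the continued fraction with minus signs. -/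

lemma exists_negative_tails {m d s e a b σ : ℝ} {C : ℕ → ℝ} (hm : 2 ≤ m) (hd : 0 < d)
    (hs : 0 < s) (hσ : σ * σ = 1) (hsum : a + b = e) (hprod : a * b = -s)
    (hC : ∀ i, (if i % 2 = 0 then s else 1) * C i = d * m ^ (i + 1) + σ * (-1) ^ (i + 1) * e)
    (hC2 : ∀ i, 2 ≤ C i)
    (hpos : ∀ i : ℕ, 0 < 1 + a * ((1 / (-m)) ^ (i + 1) / (σ * d))) :
    let q := 1 / (-m)
    let t : ℕ → ℝ := fun i => q ^ (i + 1) / (σ * d)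
    (∀ i, (∀ n, qProd q q n ≠ 0 ∧ qProd (-(a * t i)) q n ≠ 0) ∧
      Summable (hyperTerm a b q (t i)) ∧ 0 < hyperSum a b q (t i)) ∧
    ∃ w : ℕ → ℝ, (∀ i, 0 < w i) ∧ (∀ i, w i < 1) ∧ (∀ i, w i * (C i - w (i + 1)) = 1) ∧
      w 0 = s / (d * m) / (1 + a * t 0) * (hyperSum a b q (t 1) / hyperSum a b q (t 0)) := by
  intro q t
  have hm0 : (0 : ℝ) < m := by linarith
  have hσ0 : σ ≠ 0 := fun h => by simp [h] at hσ
  have hb0 : b ≠ 0 := fun h => by simp [h] at hprod; linarith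
  have hq0 : q ≠ 0 := by simp [q, hm0.ne']
  have hqabs : |q| ≤ 1 / 2 := by
    simp only [q, abs_div, abs_one, abs_neg, abs_of_pos hm0]
    exact one_div_le_one_div_of_le (by norm_num) hm
  have hqm : q * m = -1 := by
    simp only [q]
    field_simp
  have ht0 : ∀ i, t i ≠ 0 := fun i =>
    div_ne_zero (pow_ne_zero _ hq0) (mul_ne_zero hσ0 hd.ne')
  have htq : ∀ i, t i * q = t (i + 1) := fun i => by
    simp only [t, pow_succ _ (i + 1)]
    ring
  have htqn : ∀ n i, t i * q ^ n = t (i + n) := fun n i => by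
    simp only [t, add_right_comm i n 1, pow_add _ (i + 1) n]
    ring
  have hpos' : ∀ i, 0 < 1 + a * t i := hpos
  have hfac : ∀ i (n : ℕ), 1 - -(a * t i) * q ^ n ≠ 0 := fun i n => by
    have := hpos' (i + n)
    rw [← htqn] at this
    have h2 : 1 - -(a * t i) * q ^ n = 1 + a * (t i * q ^ n) := by ring
    rw [h2]
    exact this.ne'
  have hqfac : ∀ n : ℕ, 1 - q * q ^ n ≠ 0 := fun n h => by
    have h1 : |q * q ^ n| ≤ 1 / 2 := by
      rw [abs_mul, abs_pow]
      calc |q| * |q| ^ n ≤ |q| * 1 := by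
            gcongr
            exact pow_le_one₀ (abs_nonneg _) (by linarith)
        _ ≤ 1 / 2 := by linarith
    have := (abs_le.1 h1).2
    linarith
  have hsm : ∀ i, Summable (hyperTerm a b q (t i)) := fun i =>
    summable_hyperTerm (by linarith) hq0 (mul_ne_zero hb0 (ht0 i)) hqfac (hfac i)
  set F : ℕ → ℝ := fun i => hyperSum a b q (t i) with hF
  set τ : ℕ → ℝ := fun i => 1 / (d * m ^ (i + 1)) with hτ
  have hτ0 : ∀ i, 0 < τ i := fun i => by simp only [hτ]; positivity
  have htτ : ∀ i, t i = σ * (-1) ^ (i + 1) * τ i := fun i => by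
    have h1 : q ^ (i + 1) * m ^ (i + 1) = (-1) ^ (i + 1) := by rw [← mul_pow, hqm]
    simp only [t, hτ, ← h1]
    field_simp
    linear_combination -hσ
  have hsgn : ∀ i : ℕ, ((-1 : ℝ) ^ i) * (-1) ^ i = 1 := fun i => by
    rw [← mul_pow]
    norm_num
  -- An equivalence transformation: since κ_i κ_(i+1) = s, dividing by κ_(i+1) makes all partial
  -- numerators 1.
  set κ : ℕ → ℝ := fun i => if i % 2 = 0 then s else 1 with hκ
  have hκ0 : ∀ i, 0 < κ i := fun i => by
    simp only [hκ]
    split_ifs <;> linarith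
  have hκκ : ∀ i, κ i * κ (i + 1) = s := fun i => by
    rcases Nat.mod_two_eq_zero_or_one i with h | h
    · have h' : (i + 1) % 2 = 1 := by omega
      simp [hκ, h, h']
    · have h' : (i + 1) % 2 = 0 := by omega
      simp [hκ, h, h']
  have hκ2 : ∀ i, κ (i + 2) = κ i := fun i => by
    have h' : (i + 2) % 2 = i % 2 := by omega
    simp [hκ, h']
  set w : ℕ → ℝ := fun i => s * τ i / (1 + a * t i) * (F (i + 1) / F i) / κ (i + 1) with hw
  have hrec : ∀ i, F (i + 1) ≠ 0 →
      (1 + a * t i) * F i = τ i * F (i + 1) * κ i * (C i - w (i + 1)) := fun i hi => by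
    have h := hyperSum_contiguous hqfac (hfac i) (hsm i) (by rw [htq]; exact hsm _)
      (by rw [htq, htq]; exact hsm _)
    have hp := (hpos' (i + 1)).ne'
    have hD : τ i * (κ i * C i) = 1 + (a + b) * t i := by
      have h3 : τ i * (d * m ^ (i + 1)) = 1 := by
        simp only [hτ]
        field_simp
      rw [hC i, htτ, hsum]
      linear_combination h3
    have htt : t i * t (i + 1) = -(τ i * τ (i + 1)) := by
      rw [htτ, htτ, pow_succ _ (i + 1)]
      linear_combination (-(hsgn (i + 1)) * σ * σ * τ i * τ (i + 1)) - hσ * τ i * τ (i + 1)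
    have hat : 1 + a * t i * q = 1 + a * t (i + 1) := by rw [mul_assoc, htq]
    rw [hat, htq, htq, ← hD, hprod] at h
    change (1 + a * t i) * F i = τ i * (κ i * C i) * F (i + 1) -
      -s * t i ^ 2 * q / (1 + a * t (i + 1)) * F (i + 1 + 1) at h
    have h4 : -s * t i ^ 2 * q = s * (τ i * τ (i + 1)) := by
      have : -s * t i ^ 2 * q = -s * (t i * (t i * q)) := by ring
      rw [this, htq, htt]
      ring
    rw [h, h4]
    have hk := (hκ0 i).ne'
    simp only [hw, hκ2]
    field_simp
  have hwrec : ∀ i, F i ≠ 0 → F (i + 1) ≠ 0 → w i * (C i - w (i + 1)) = 1 :=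
    fun i h1 h2 => by
    have h := hrec i h2
    have hp := (hpos' i).ne'
    have hk := (hκ0 (i + 1)).ne'
    have hk0 := (hκ0 i).ne'
    have h3 : w i * ((1 + a * t i) * F i * κ (i + 1)) = s * τ i * F (i + 1) := by
      simp only [hw]
      field_simp
    have h5 : ((1 + a * t i) * F i * κ (i + 1)) * (w i * (C i - w (i + 1))) =
        ((1 + a * t i) * F i * κ (i + 1)) * 1 := by
      linear_combination (C i - w (i + 1)) * h3 - κ (i + 1) * h -
        τ i * F (i + 1) * (C i - w (i + 1)) * hκκ i
    exact mul_left_cancel₀ (mul_ne_zero (mul_ne_zero hp h1) hk) h5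
  have hpow : Tendsto (fun i : ℕ => q ^ (i + 1)) atTop (𝓝 0) :=
    (tendsto_add_atTop_iff_nat 1).2 (tendsto_pow_atTop_nhds_zero_of_abs_lt_one (by linarith))
  have htlim : Tendsto t atTop (𝓝 0) := by
    simpa using hpow.div_const (σ * d)
  have hτlim : Tendsto τ atTop (𝓝 0) := by
    have h2 : ∀ i, τ i = |t i| := fun i => by
      have hσ1 : |σ| = 1 := by
        rcases mul_self_eq_one_iff.1 hσ with h | h <;> simp [h]
      rw [htτ, abs_mul, abs_mul, hσ1, abs_pow, abs_neg, abs_one, one_pow, abs_of_pos (hτ0 i)]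
      ring
    simpa [← funext h2] using htlim.abs
  have hFlim : Tendsto F atTop (𝓝 1) := tendsto_hyperSum hqabs htlim
  have hrlim : Tendsto (fun i => s * τ i / (1 + a * t i) * (F (i + 1) / F i)) atTop (𝓝 0) := by
    have h1 : Tendsto (fun i => s * τ i / (1 + a * t i) * (F (i + 1) / F i)) atTop
        (𝓝 (s * 0 / (1 + a * 0) * (1 / 1))) :=
      ((hτlim.const_mul s).div ((htlim.const_mul a).const_add 1) (by simp)).mul
        (((tendsto_add_atTop_iff_nat 1).2 hFlim).div hFlim one_ne_zero)
    simpa using h1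
  -- The bound min(s, 1) covers both values of κ, so w_i < 1 whatever the parity of i.
  obtain ⟨K, hK⟩ := ((hFlim.eventually_const_lt one_half_lt_one).and
    (hrlim.eventually_lt_const (lt_min hs one_pos))).exists_forall_of_atTop
  have hFpos : ∀ i, K ≤ i → 0 < F i := fun i hi => lt_trans (by norm_num) (hK i hi).1
  have hbig : ∀ i, K ≤ i → 0 < F i ∧ 0 < w i ∧ w i < 1 := fun i hi => by
    have f0 := hFpos i hi
    have f1 := hFpos (i + 1) (by omega)
    have hp := hpos' i
    have ht := hτ0 i
    have hk := hκ0 (i + 1)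
    refine ⟨f0, by simp only [hw]; positivity, ?_⟩
    simp only [hw]
    rw [div_lt_one hk]
    refine (hK i hi).2.trans_le ?_
    simp only [hκ]
    split_ifs
    · exact min_le_left _ _
    · exact min_le_right _ _
  -- Descent: C_i ≥ 2 and w_(i+1) < 1 give C_i - w_(i+1) > 1, so the recurrence forces F_i > 0 and
  -- then 0 < w_i < 1.
  have hstep : ∀ i, (0 < F (i + 1) ∧ 0 < w (i + 1) ∧ w (i + 1) < 1) →
      (0 < F i ∧ 0 < w i ∧ w i < 1) := fun i ⟨f1, w0, w1⟩ => by
    have h := hrec i f1.ne'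
    have hp := hpos' i
    have hc : 1 < C i - w (i + 1) := by linarith [hC2 i]
    have hr : 0 < τ i * F (i + 1) * κ i * (C i - w (i + 1)) :=
      mul_pos (mul_pos (mul_pos (hτ0 i) f1) (hκ0 i)) (by linarith)
    have f0 : 0 < F i := by
      rw [← h] at hr
      exact pos_of_mul_pos_right hr hp.le
    have hwr := hwrec i f0.ne' f1.ne'
    have hwi : 0 < w i := by
      refine pos_of_mul_pos_left (b := C i - w (i + 1)) ?_ (by linarith)
      rw [hwr]
      exact one_pos
    refine ⟨f0, hwi, ?_⟩
    nlinarith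
  have hall : ∀ n i, K ≤ i + n → (0 < F i ∧ 0 < w i ∧ w i < 1) := by
    intro n
    induction n with
    | zero => exact fun i hi => hbig i hi
    | succ n ih => exact fun i hi => hstep i (ih (i + 1) (by omega))
  have hall' : ∀ i, 0 < F i ∧ 0 < w i ∧ w i < 1 := fun i => hall K i (by omega)
  refine ⟨fun i => ⟨fun n => ⟨qProd_ne_zero hqfac n, qProd_ne_zero (hfac i) n⟩, hsm i,
    (hall' i).1⟩, w, fun i => (hall' i).2.1, fun i => (hall' i).2.2,
    fun i => hwrec i (hall' i).1.ne' (hall' (i + 1)).1.ne', ?_⟩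
  simp [hw, hτ, hκ, hF, div_eq_mul_inv]

/-! ### Translation to the series of the theorem. -/

lemma neg_mul_base_eq {m δ : ℝ} (a : ℝ) (hm : m ≠ 0) (hδ : δ ≠ 0) :
    -(a * ((1 / (-m)) ^ (0 + 1) / δ)) = a / (δ * m) := by
  rw [zero_add, pow_one]
  field_simp

lemma neg_mul_base_sq_eq {m δ : ℝ} (a : ℝ) (hm : m ≠ 0) (hδ : δ ≠ 0) :
    -(a * ((1 / (-m)) ^ (1 + 1) / δ)) = -a / (δ * m ^ 2) := by
  rw [one_add_one_eq_two, div_pow, neg_sq]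
  field_simp

lemma qTerm_one_eq {m δ : ℝ} (a b : ℝ) (hm : m ≠ 0) (hδ : δ ≠ 0) :
    qTerm (b / δ) (-m) (a / (δ * m)) 1 =
      hyperTerm a b (1 / (-m)) ((1 / (-m)) ^ (0 + 1) / δ) := by
  funext n
  have h1 : n * (n + 1) / 2 = n.choose 2 + n := by
    have h := Nat.choose_two_right (n + 1)
    rw [Nat.choose_succ_succ' n 1, Nat.choose_one_right, Nat.add_sub_cancel] at h
    rw [mul_comm, ← h, add_comm]
  rw [qTerm, hyperTerm, h1, neg_mul_base_eq a hm hδ]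
  congr 1
  rw [zpow_neg, zpow_natCast, ← inv_pow, one_div, pow_add]
  generalize (-m)⁻¹ = p
  ring

lemma qTerm_three_eq {m δ : ℝ} (a b : ℝ) (hm : m ≠ 0) (hδ : δ ≠ 0) :
    qTerm (b / δ) (-m) (-a / (δ * m ^ 2)) 3 =
      hyperTerm a b (1 / (-m)) ((1 / (-m)) ^ (1 + 1) / δ) := by
  funext n
  have h1 : n * (n + 3) / 2 = n.choose 2 + n + n := by
    have h := Nat.choose_two_right (n + 1)
    rw [Nat.choose_succ_succ' n 1, Nat.choose_one_right, Nat.add_sub_cancel] at h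
    have h3 : n * (n + 3) = (n + 1) * n + 2 * n := by ring
    rw [h3, Nat.add_mul_div_left _ _ two_pos, ← h, add_comm n]
  rw [qTerm, hyperTerm, h1, neg_mul_base_sq_eq a hm hδ]
  congr 1
  rw [zpow_neg, zpow_natCast, ← inv_pow, one_div, pow_add, pow_add]
  generalize (-m)⁻¹ = p
  ring

lemma qSeries_solution {m d s e a b σ : ℝ} {C : ℕ → ℝ} (hm : 2 ≤ m) (hd : 0 < d)
    (hs : 0 < s) (hσ : σ * σ = 1) (hsum : a + b = e) (hprod : a * b = -s)
    (hC : ∀ i, (if i % 2 = 0 then s else 1) * C i = d * m ^ (i + 1) + σ * (-1) ^ (i + 1) * e)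
    (hC2 : ∀ i, 2 ≤ C i) (ha : a < 0)
    (hbd : ∀ i : ℕ, σ * (-1) ^ (i + 1) = 1 → -a < d * m ^ (i + 1)) :
    QSeriesDefined (b / (σ * d)) (-m) (-a / (σ * d * m ^ 2)) 3 ∧
    QSeriesDefined (b / (σ * d)) (-m) (a / (σ * d * m)) 1 ∧
    qSeries (b / (σ * d)) (-m) (a / (σ * d * m)) 1 ≠ 0 ∧
    ∃ w : ℕ → ℝ, (∀ i, 0 < w i) ∧ (∀ i, w i < 1) ∧ (∀ i, w i * (C i - w (i + 1)) = 1) ∧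
      w 0 = s / (d * m - σ * a) * (qSeries (b / (σ * d)) (-m) (-a / (σ * d * m ^ 2)) 3 /
        qSeries (b / (σ * d)) (-m) (a / (σ * d * m)) 1) := by
  have hm0 : (0 : ℝ) < m := by linarith
  have hσ0 : σ ≠ 0 := fun h => by simp [h] at hσ
  have hδ : σ * d ≠ 0 := mul_ne_zero hσ0 hd.ne'
  have hpos : ∀ i : ℕ, 0 < 1 + a * ((1 / (-m)) ^ (i + 1) / (σ * d)) := fun i => by
    have hD : 0 < d * m ^ (i + 1) := by positivity
    have h1 : (1 / (-m)) ^ (i + 1) / (σ * d) = σ * (-1) ^ (i + 1) / (d * m ^ (i + 1)) := by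
      have h2 : (1 / (-m)) ^ (i + 1) = (-1) ^ (i + 1) / m ^ (i + 1) := by
        rw [← div_pow]
        congr 1
        field_simp
      rw [h2]
      field_simp
      linear_combination -hσ
    rw [h1]
    -- This is the sign of t_i. As a < 0, only t_i > 0 threatens positivity of 1 + a t_i; hence the
    -- restricted hypothesis `hbd`.
    have h3 : σ * (-1) ^ (i + 1) = 1 ∨ σ * (-1) ^ (i + 1) = -1 := by
      rw [← mul_self_eq_one_iff]
      have h4 : ((-1 : ℝ) ^ (i + 1)) * (-1) ^ (i + 1) = 1 := by
        rw [← mul_pow]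
        norm_num
      linear_combination σ * σ * h4 + hσ
    rcases h3 with h | h
    · have h5 := hbd i h
      rw [h, mul_one_div]
      have : -1 < a / (d * m ^ (i + 1)) := by
        rw [lt_div_iff₀ hD]
        linarith
      linarith
    · rw [h, mul_div_assoc']
      have : 0 < a * -1 / (d * m ^ (i + 1)) := div_pos (by linarith) hD
      linarith
  obtain ⟨hF, w, hw0, hw1, hwr, hwv⟩ :=
    exists_negative_tails hm hd hs hσ hsum hprod hC hC2 hpos
  dsimp only at hF hwv
  have T1 := qTerm_one_eq a b hm0.ne' hδ
  have T3 := qTerm_three_eq a b hm0.ne' hδ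
  have A1 := neg_mul_base_eq a hm0.ne' hδ
  have A3 := neg_mul_base_sq_eq a hm0.ne' hδ
  have S1 : qSeries (b / (σ * d)) (-m) (a / (σ * d * m)) 1 =
      hyperSum a b (1 / (-m)) ((1 / (-m)) ^ (0 + 1) / (σ * d)) := by
    rw [hyperSum, ← T1]
    rfl
  have S3 : qSeries (b / (σ * d)) (-m) (-a / (σ * d * m ^ 2)) 3 =
      hyperSum a b (1 / (-m)) ((1 / (-m)) ^ (1 + 1) / (σ * d)) := by
    rw [hyperSum, ← T3]
    rfl
  obtain ⟨p0, s0, f0⟩ := hF 0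
  obtain ⟨p1, s1, -⟩ := hF 1
  rw [A1] at p0
  rw [A3] at p1
  rw [← T1] at s0
  rw [← T3] at s1
  refine ⟨⟨p1, s1⟩, ⟨p0, s0⟩, S1 ▸ f0.ne', w, hw0, hw1, hwr, ?_⟩
  rw [hwv, S1, S3]
  congr 1
  rw [div_div]
  congr 1
  rw [zero_add, pow_one]
  field_simp
  linear_combination a * hσ

/-! ### Partial quotients, integrality and bounds. -/

lemma interlace4_alternating (f g : ℕ → ℝ) (k : ℕ) :
    interlace4 ![fun _ => 1, f, fun _ => 1, g] k =
      if k % 2 = 0 then 1 else if (k / 2) % 2 = 0 then f (k / 4 + 1) else g (k / 4 + 1) := by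
  have hk : k % 4 = 0 ∨ k % 4 = 1 ∨ k % 4 = 2 ∨ k % 4 = 3 := by omega
  rcases hk with h | h | h | h
  · have h2 : k % 2 = 0 := by omega
    simp [interlace4, h, h2]
  · have h2 : k % 2 = 1 := by omega
    have h3 : (k / 2) % 2 = 0 := by omega
    simp [interlace4, h, h2, h3]
  · have h2 : k % 2 = 0 := by omega
    simp [interlace4, h, h2]
  · have h2 : k % 2 = 1 := by omega
    have h3 : (k / 2) % 2 = 1 := by omega
    simp [interlace4, h, h2, h3]

/-- The coefficients of the continued fraction with minus signs that contracts to the regular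
continued fractions `quotientsOne` (with `σ = 1`) and `quotientsTwo` (with `σ = -1`). -/
def negCoeff (c e m σ : ℤ) (N₁ N₂ : ℕ) (i : ℕ) : ℤ :=
  if i % 2 = 0 then N₁ * m ^ i - σ * c else N₂ * m ^ (i - 1) + σ * e

lemma negCoeff_zero (c e m σ : ℤ) (N₁ N₂ : ℕ) : negCoeff c e m σ N₁ N₂ 0 = N₁ - σ * c := by
  simp [negCoeff]

lemma three_le_negCoeff {c e m σ : ℤ} {N₁ N₂ : ℕ} (hm : 1 < m) (hN₁ : 0 < N₁)
    (h₁ : 2 ≤ N₁ - σ * c) (h₂ : 3 ≤ N₂ + σ * e) (i : ℕ) (hi : i ≠ 0) :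
    3 ≤ negCoeff c e m σ N₁ N₂ i := by
  unfold negCoeff
  split_ifs with h
  · have h3 : 1 < m ^ i := one_lt_pow₀ hm hi
    have h4 : (1 : ℤ) ≤ N₁ := by exact_mod_cast hN₁
    nlinarith
  · have h3 : 1 ≤ m ^ (i - 1) := one_le_pow₀ hm.le
    nlinarith [Int.natCast_nonneg N₂]

lemma exists_nat_eq_intCast {z : ℤ} {x : ℝ} (hz : 0 < z) (hx : x = z) :
    ∃ N : ℕ, 0 < N ∧ x = (N : ℝ) :=
  ⟨z.toNat, by omega, by rw [hx, ← Int.cast_natCast, Int.toNat_of_nonneg hz.le]⟩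

/-- The hypothesis says y² + ey - s = (y + a)(y + b) > 0, and y + b > 0. -/
lemma neg_root_lt {a b s e y : ℝ} (hsum : a + b = e) (hprod : a * b = -s) (hb : 0 < b)
    (hy : 0 < y) (h : s < y * (y + e)) : -a < y := by
  by_contra! hc
  nlinarith [mul_nonneg (sub_nonneg.2 hc) (add_pos hy hb).le]

/-- Supplies the hypothesis of `neg_root_lt` in part (ii), where y = dm = sN and e = sc. -/
lemma lt_scaled_mul_add {s c N : ℝ} (hs : 0 < s) (hN : 1 ≤ N) (h : 2 ≤ N + c)
    (hsign : (1 ≤ c ∧ 1 ≤ s * c) ∨ (c ≤ -1 ∧ s * c ≤ -1)) : s < s * N * (s * N + s * c) := by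
  have h4 : 1 < N * (s * (N + c)) := by
    rcases hsign with ⟨-, g2⟩ | ⟨-, g2⟩
    · have h5 : 1 < s * (N + c) := by
        nlinarith
      nlinarith
    · have h5 : N * s * 2 ≤ N * s * (N + c) :=
        mul_le_mul_of_nonneg_left h (by positivity)
      nlinarith
  calc s = s * 1 := (mul_one s).symm
    _ < s * (N * (s * (N + c))) := mul_lt_mul_of_pos_left h4 hs
    _ = _ := by ring

end Tasoev

/-! ### The main theorem. -/

theorem mainTheorem9 (c e m : ℤ) (d : ℚ) (hm : 1 < m) (hd : 0 < d)
    (hdm : ∃ N : ℕ, 0 < N ∧ d * (m : ℚ) ^ 2 = (N : ℚ))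
    (he : e ≠ 0) (hdc : ∃ N : ℕ, 0 < N ∧ d * (c : ℚ) * (m : ℚ) / (e : ℚ) = (N : ℚ))
    (a b : ℝ)
    (ha : a = ((e : ℝ) - Real.sqrt ((e : ℝ) ^ 2 + 4 * (e : ℝ) / (c : ℝ))) / 2)
    (hb : b = ((e : ℝ) + Real.sqrt ((e : ℝ) ^ 2 + 4 * (e : ℝ) / (c : ℝ))) / 2) :
    (0 < d * (c : ℚ) * (m : ℚ) / (e : ℚ) - (c : ℚ) - 2 → 0 < d * (m : ℚ) ^ 2 + (e : ℚ) - 2 →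
      -(m : ℝ) * (d : ℝ) + a ≠ 0 ∧
      Tasoev.QSeriesDefined (b / d) (-(m : ℝ)) (-a / (d * (m : ℝ) ^ 2)) 3 ∧
      Tasoev.QSeriesDefined (b / d) (-(m : ℝ)) (a / (d * (m : ℝ))) 1 ∧
      Tasoev.qSeries (b / d) (-(m : ℝ)) (a / (d * (m : ℝ))) 1 ≠ 0 ∧
      Tasoev.IsRegularCFOf (Tasoev.quotientsOne c e m d)
        (1 + ((e : ℝ) / (c : ℝ)) / (-(m : ℝ) * (d : ℝ) + a) *
          (Tasoev.qSeries (b / d) (-(m : ℝ)) (-a / (d * (m : ℝ) ^ 2)) 3 /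
            Tasoev.qSeries (b / d) (-(m : ℝ)) (a / (d * (m : ℝ))) 1))) ∧
    (0 < d * (c : ℚ) * (m : ℚ) / (e : ℚ) + (c : ℚ) - 1 → 0 < d * (m : ℚ) ^ 2 - (e : ℚ) - 2 →
      (m : ℝ) * (d : ℝ) + a ≠ 0 ∧
      Tasoev.QSeriesDefined (-b / d) (-(m : ℝ)) (a / (d * (m : ℝ) ^ 2)) 3 ∧
      Tasoev.QSeriesDefined (-b / d) (-(m : ℝ)) (-a / (d * (m : ℝ))) 1 ∧
      Tasoev.qSeries (-b / d) (-(m : ℝ)) (-a / (d * (m : ℝ))) 1 ≠ 0 ∧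
      Tasoev.IsRegularCFOf (Tasoev.quotientsTwo c e m d)
        (((e : ℝ) / (c : ℝ)) / ((m : ℝ) * (d : ℝ) + a) *
          (Tasoev.qSeries (-b / d) (-(m : ℝ)) (a / (d * (m : ℝ) ^ 2)) 3 /
            Tasoev.qSeries (-b / d) (-(m : ℝ)) (-a / (d * (m : ℝ))) 1))) := by
  obtain ⟨N₁, hN₁, hd₁⟩ := hdc
  obtain ⟨N₂, hN₂, hd₂⟩ := hdm
  have hc : c ≠ 0 := fun h => by
    rw [h, Int.cast_zero, mul_zero, zero_mul, zero_div] at hd₁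
    exact hN₁.ne' (by exact_mod_cast hd₁.symm)
  rw [hd₁, hd₂]
  have hcR : (c : ℝ) ≠ 0 := Int.cast_ne_zero.2 hc
  have heR : (e : ℝ) ≠ 0 := Int.cast_ne_zero.2 he
  have hm2 : (2 : ℝ) ≤ m := by exact_mod_cast hm
  have hm0 : (0 : ℝ) < m := by linarith
  have hdR : (0 : ℝ) < d := by exact_mod_cast hd
  have hN₁R : (1 : ℝ) ≤ N₁ := by exact_mod_cast hN₁
  have hN₂R : (1 : ℝ) ≤ N₂ := by exact_mod_cast hN₂
  have e₁ : (d : ℝ) * c * m / e = N₁ := by exact_mod_cast congrArg (Rat.cast (K := ℝ)) hd₁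
  have e₂ : (d : ℝ) * (m : ℝ) ^ 2 = N₂ := by exact_mod_cast congrArg (Rat.cast (K := ℝ)) hd₂
  obtain ⟨s, hs⟩ : ∃ s : ℝ, s = (e : ℝ) / c := ⟨_, rfl⟩
  have hsc : s * c = e := by
    rw [hs]
    field_simp
  have hdm : (d : ℝ) * m = s * N₁ := by
    rw [← e₁, hs]
    field_simp
  have hs0 : 0 < s := by
    have : 0 < s * N₁ := hdm ▸ mul_pos hdR hm0
    exact pos_of_mul_pos_left this (by linarith)
  have hsign : ((1 : ℝ) ≤ c ∧ (1 : ℝ) ≤ e) ∨ ((c : ℝ) ≤ -1 ∧ (e : ℝ) ≤ -1) := by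
    rcases lt_or_gt_of_ne hc with h | h
    · have h1 : (c : ℝ) ≤ -1 := by exact_mod_cast Int.le_sub_one_of_lt h
      have h2 : (e : ℝ) < 0 := by
        rw [← hsc]
        nlinarith
      have h3 : e < 0 := by exact_mod_cast h2
      exact Or.inr ⟨h1, by exact_mod_cast Int.le_sub_one_of_lt h3⟩
    · have h1 : (1 : ℝ) ≤ c := by exact_mod_cast h
      have h2 : (0 : ℝ) < e := by
        rw [← hsc]
        nlinarith
      have h3 : 0 < e := by exact_mod_cast h2
      exact Or.inl ⟨h1, by exact_mod_cast h3⟩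
  rw [mul_div_assoc, ← hs] at ha hb
  have hrad : 0 ≤ (e : ℝ) ^ 2 + 4 * s := by positivity
  have hsq := Real.sq_sqrt hrad
  have hsum : a + b = e := by
    rw [ha, hb]
    ring
  have hprod : a * b = -s := by
    rw [ha, hb]
    linear_combination -hsq / 4
  have hab : a ≤ b := by
    rw [ha, hb]
    linarith [Real.sqrt_nonneg ((e : ℝ) ^ 2 + 4 * s)]
  have hb0 : 0 < b := by
    by_contra! h
    nlinarith [mul_nonneg_of_nonpos_of_nonpos (hab.trans h) h]
  have ha0 : a < 0 := by
    by_contra! h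
    nlinarith [mul_nonneg h hb0.le]
  have hcoef : ∀ (σ : ℤ) (i : ℕ), (if i % 2 = 0 then s else 1) *
      (Tasoev.negCoeff c e m σ N₁ N₂ i : ℝ) =
      d * (m : ℝ) ^ (i + 1) + (σ : ℝ) * (-1) ^ (i + 1) * e := fun σ i => by
    unfold Tasoev.negCoeff
    rcases Nat.even_or_odd i with h | h
    · rw [if_pos (Nat.even_iff.1 h), if_pos (Nat.even_iff.1 h), (h.add_one).neg_one_pow]
      push_cast
      rw [pow_succ]
      linear_combination -(m : ℝ) ^ i * hdm - σ * hsc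
    · have h' : ¬ i % 2 = 0 := by
        rw [Nat.odd_iff.1 h]
        norm_num
      rw [if_neg h', if_neg h', (h.add_one).neg_one_pow]
      obtain ⟨j, rfl⟩ := h
      push_cast
      rw [← e₂]
      ring
  have hdcm : (d : ℝ) * c / e * m = N₁ := by
    rw [← e₁]
    ring
  have hquot₁ : ∀ n j : ℕ, n = j + 1 → (d : ℝ) * c / e * (m : ℝ) ^ n = N₁ * (m : ℝ) ^ j := by
    rintro _ j rfl
    rw [pow_succ, ← hdcm]
    ring
  have hquot₂ : ∀ n j : ℕ, n = j + 2 → (d : ℝ) * (m : ℝ) ^ n = N₂ * (m : ℝ) ^ j := by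
    rintro _ j rfl
    rw [pow_add, ← e₂]
    ring
  have hmono : ∀ i j : ℕ, i ≤ j → (d : ℝ) * (m : ℝ) ^ i ≤ d * (m : ℝ) ^ j := fun i j hij =>
    mul_le_mul_of_nonneg_left (pow_le_pow_right₀ (by linarith) hij) hdR.le
  constructor
  · intro h₁ h₂
    have h₁' : (3 : ℤ) ≤ N₁ - c := by
      have : (0 : ℤ) < N₁ - c - 2 := by exact_mod_cast h₁
      omega
    have h₂' : (3 : ℤ) ≤ N₂ + e := by
      have : (0 : ℤ) < N₂ + e - 2 := by exact_mod_cast h₂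
      omega
    have h₂R : (3 : ℝ) ≤ N₂ + e := by exact_mod_cast h₂'
    have hC : ∀ i, 3 ≤ Tasoev.negCoeff c e m 1 N₁ N₂ i := fun i => by
      rcases eq_or_ne i 0 with rfl | hi
      · rw [Tasoev.negCoeff_zero]
        omega
      · exact Tasoev.three_le_negCoeff hm hN₁ (by omega) (by omega) i hi
    have hCR : ∀ i, (3 : ℝ) ≤ Tasoev.negCoeff c e m 1 N₁ N₂ i := fun i => by exact_mod_cast hC i
    -- With σ = 1, t_i is positive only for odd i, so the tightest bound is at i = 1, where d m² =
    -- N₂.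
    have hbd : -a < N₂ := by
      refine Tasoev.neg_root_lt hsum hprod hb0 (by linarith) ?_
      rcases hsign with ⟨g1, g2⟩ | ⟨g1, g2⟩ <;> nlinarith
    obtain ⟨q3, q1, qne, w, hw0, hw1, hwr, hwv⟩ := Tasoev.qSeries_solution hm2 hdR hs0
      (σ := ((1 : ℤ) : ℝ)) (by norm_num) hsum hprod (hcoef 1)
      (fun i => by linarith [hCR i]) ha0 (fun i hi => by
        have hi' : i ≠ 0 := by
          rintro rfl
          norm_num at hi
        calc -a < d * (m : ℝ) ^ 2 := by rw [e₂]; exact hbd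
          _ ≤ _ := hmono _ _ (by omega))
    rw [Int.cast_one, one_mul] at q3 q1 qne hwv
    rw [one_mul] at hwv
    refine ⟨by nlinarith, q3, q1, qne, ?_⟩
    have hx := Tasoev.tails_of_negative hCR hw0 hw1 hwr
    have hb : Tasoev.quotientsOne c e m d = fun k => if k % 2 = 0 then 1 else
        ((Tasoev.negCoeff c e m 1 N₁ N₂ (k / 2) : ℝ) - 2) := by
      funext k
      rw [Tasoev.quotientsOne, Tasoev.interlace4_alternating]
      by_cases hk : k % 2 = 0
      · rw [if_pos hk, if_pos hk]
      · rw [if_neg hk, if_neg hk, Tasoev.negCoeff]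
        split_ifs with hk2
        · rw [hquot₁ _ (k / 2) (by omega)]
          push_cast
          ring
        · rw [hquot₂ _ (k / 2 - 1) (by omega)]
          push_cast
          ring
    have hval : 1 + (e : ℝ) / c / (-(m : ℝ) * d + a) *
        (Tasoev.qSeries (b / d) (-(m : ℝ)) (-a / (d * (m : ℝ) ^ 2)) 3 /
          Tasoev.qSeries (b / d) (-(m : ℝ)) (a / (d * (m : ℝ))) 1) = 1 - w 0 := by
      have h3 : -(m : ℝ) * d + a = -(d * m - a) := by ring
      rw [hwv, ← hs, h3, div_neg]
      ring
    rw [hval, hb]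
    refine Tasoev.isRegularCFOf_of_tails (x := fun k => if k % 2 = 0 then 1 - w (k / 2) else
      w (k / 2) / (1 - w (k / 2))) (fun k => ?_) (fun k => (hx k).1) (fun k => (hx k).2.1)
      (fun k => (hx k).2.2)
    split_ifs
    · exact ⟨1, one_pos, by simp⟩
    · have := hC (k / 2)
      exact Tasoev.exists_nat_eq_intCast (z := Tasoev.negCoeff c e m 1 N₁ N₂ (k / 2) - 2)
        (by omega) (by push_cast; rfl)
  · intro h₁ h₂
    have h₁' : (2 : ℤ) ≤ N₁ + c := by
      have : (0 : ℤ) < N₁ + c - 1 := by exact_mod_cast h₁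
      omega
    have h₂' : (3 : ℤ) ≤ N₂ - e := by
      have : (0 : ℤ) < N₂ - e - 2 := by exact_mod_cast h₂
      omega
    have h₁R : (2 : ℝ) ≤ N₁ + c := by exact_mod_cast h₁'
    have hC : ∀ i, 3 ≤ Tasoev.negCoeff c e m (-1) N₁ N₂ (i + 1) := fun i =>
      Tasoev.three_le_negCoeff hm hN₁ (by omega) (by omega) _ (Nat.succ_ne_zero i)
    have hC0 : Tasoev.negCoeff c e m (-1) N₁ N₂ 0 = N₁ + c := by
      rw [Tasoev.negCoeff_zero]
      ring
    have hCR : ∀ i, (3 : ℝ) ≤ Tasoev.negCoeff c e m (-1) N₁ N₂ (i + 1) := fun i => by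
      exact_mod_cast hC i
    -- With σ = -1, t_0 is already positive, so the bound is needed at dm.
    have hbd : -a < d * m := by
      refine Tasoev.neg_root_lt hsum hprod hb0 (mul_pos hdR hm0) ?_
      rw [hdm, ← hsc]
      refine Tasoev.lt_scaled_mul_add hs0 hN₁R h₁R ?_
      rw [hsc]
      exact hsign
    obtain ⟨q3, q1, qne, w, hw0, hw1, hwr, hwv⟩ := Tasoev.qSeries_solution hm2 hdR hs0
      (σ := ((-1 : ℤ) : ℝ)) (by norm_num) hsum hprod (hcoef (-1))
      (fun i => by
        rcases i with _ | i
        · exact_mod_cast hC0 ▸ h₁'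
        · linarith [hCR i]) ha0 (fun i _ => by
        calc -a < d * (m : ℝ) ^ 1 := by rw [pow_one]; exact hbd
          _ ≤ _ := hmono _ _ (by omega))
    have r1 : b / (((-1 : ℤ) : ℝ) * d) = -b / d := by
      push_cast
      rw [neg_one_mul, div_neg, neg_div]
    have r2 : -a / (((-1 : ℤ) : ℝ) * d * (m : ℝ) ^ 2) = a / (d * (m : ℝ) ^ 2) := by
      push_cast
      rw [neg_one_mul, neg_mul, neg_div_neg_eq]
    have r3 : a / (((-1 : ℤ) : ℝ) * d * (m : ℝ)) = -a / (d * (m : ℝ)) := by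
      push_cast
      rw [neg_one_mul, neg_mul, div_neg, neg_div]
    rw [r1, r2] at q3
    rw [r1, r3] at q1 qne
    rw [r1, r2, r3] at hwv
    refine ⟨by nlinarith, q3, q1, qne, ?_⟩
    have hx := Tasoev.tails_of_negative hCR (fun i => hw0 (i + 1)) (fun i => hw1 (i + 1))
      (fun i => hwr (i + 1))
    have hb : ∀ k, Tasoev.quotientsTwo c e m d (k + 1) = if k % 2 = 0 then 1 else
        ((Tasoev.negCoeff c e m (-1) N₁ N₂ (k / 2 + 1) : ℝ) - 2) := by
      intro k
      rw [Tasoev.quotientsTwo, Tasoev.interlace4_alternating]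
      by_cases hk : k % 2 = 0
      · rw [if_pos hk, if_pos hk]
      · rw [if_neg hk, if_neg hk, Tasoev.negCoeff]
        by_cases hk2 : k / 2 % 2 = 0
        · have hk3 : ¬ (k / 2 + 1) % 2 = 0 := by omega
          rw [if_pos hk2, if_neg hk3, hquot₂ _ (k / 2 + 1 - 1) (by omega)]
          push_cast
          ring
        · have hk3 : (k / 2 + 1) % 2 = 0 := by omega
          rw [if_neg hk2, if_pos hk3, hquot₁ _ (k / 2 + 1) (by omega)]
          push_cast
          ring
    have hb0' : Tasoev.quotientsTwo c e m d 0 = N₁ + c - 1 := by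
      rw [Tasoev.quotientsTwo, hdcm]
    have hval : (e : ℝ) / c / ((m : ℝ) * d + a) *
        (Tasoev.qSeries (-b / d) (-(m : ℝ)) (a / (d * (m : ℝ) ^ 2)) 3 /
          Tasoev.qSeries (-b / d) (-(m : ℝ)) (-a / (d * (m : ℝ))) 1) = w 0 := by
      rw [hwv, ← hs]
      push_cast
      rw [neg_one_mul, sub_neg_eq_add, mul_comm (m : ℝ)]
    rw [hval]
    -- C_0 may equal 2, so w_0 itself is kept as the first tail, with quotient C_0 - 1 ≥ 1; the
    -- alternating conversion starts at w_1.
    refine Tasoev.isRegularCFOf_of_tails (x := fun k => Nat.casesOn k (w 0) fun k =>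
      if k % 2 = 0 then 1 - w (k / 2 + 1) else w (k / 2 + 1) / (1 - w (k / 2 + 1)))
      (fun k => ?_) (fun k => ?_) (fun k => ?_) (fun k => ?_)
    · rcases k with _ | k
      · exact Tasoev.exists_nat_eq_intCast (z := N₁ + c - 1) (by omega)
          (by rw [hb0']; push_cast; rfl)
      · rw [hb]
        split_ifs
        · exact ⟨1, one_pos, by simp⟩
        · have := hC (k / 2)
          exact Tasoev.exists_nat_eq_intCast
            (z := Tasoev.negCoeff c e m (-1) N₁ N₂ (k / 2 + 1) - 2) (by omega) (by push_cast; rfl)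
    · rcases k with _ | k
      · exact hw0 0
      · exact (hx k).1
    · rcases k with _ | k
      · exact hw1 0
      · exact (hx k).2.1
    · rcases k with _ | k
      · have h3 := hwr 0
        rw [hC0] at h3
        push_cast at h3
        simp only [hb0', Nat.zero_mod, Nat.zero_div, if_true]
        linear_combination h3
      · rw [hb]
        exact (hx k).2.2
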